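/- Let $A,B,C,D$ be real matrices of sizes $m\times m$, $m\times n$, $n\times m$, $n\times n$, and let $$K=\begin{bmatrix} D & -C\\ -B & A\end{bmatrix},\qquad H=\begin{bmatrix} I_n & 0\\ 0 & -I_m\end{bmatrix}K .$$ Inequalities between matrices or vectors are entrywise and $\rho$ denotes the spectral radius. A real square matrix is an $M$-matrix if it can be written as $sI-N$ with $N\ge 0$ and $s\ge\rho(N)$; it is a singular $M$-matrix if $s=\rho(N)$ and a nonsingular $M$-matrix if $s>\rho(N)$. An $M$-matrix $M$ is regular if $Mw\ge 0$ for some vector $w>0$. Suppose that $K$ is a regular singular $M$-matrix and that $H$ has exactly one linearly independent eigenvector for the eigenvalue $0$ (of whatever algebraic multiplicity). Let $u_1,v_1\in\mathbb R^n$ and $u_2,v_2\in\mathbb R^m$ be such that $\begin{bmatrix}u_1\\u_2\end{bmatrix}$ and $\begin{bmatrix}v_1\\v_2\end{bmatrix}$ are nonzero and $$[u_1^T\ \ u_2^T]\,K=0,\qquad K\begin{bmatrix}v_1\\v_2\end{bmatrix}=0$$ (each of these vectors is unique up to a nonzero scalar multiple). If $u_1^Tv_1\ne u_2^Tv_2$,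 then the equations $$XCX-XD-AX+B=0\qquad\text{and}\qquad YBY-YA-DY+C=0$$ have minimal nonnegative solutions $\Phi$ and $\Psi$ respectively (that is, $\Phi\ge0$ is a solution with $\Phi\le X$ for every solution $X\ge 0$, and likewise for $\Psi$), and $I_m-\Phi\Psi$ and $I_n-\Psi\Phi$ are nonsingular $M$-matrices. -/

import Mathlib

namespace MRiccati

/-- Spectral radius of a real square matrix: the largest modulus of its complex eigenvalues.
The spectrum of a matrix is finite, so the extended value is finite and `toReal` loses nothing. -/
noncomputable def rho {ι : Type*} [Fintype ι] [DecidableEq ι] (B : Matrix ι ι ℝ) : ℝ :=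
  (spectralRadius ℂ (B.map (algebraMap ℝ ℂ))).toReal

/-- Entrywise nonnegativity. -/
def Nonneg {ι κ : Type*} (X : Matrix ι κ ℝ) : Prop := ∀ i j, 0 ≤ X i j

/-- `M`-matrix: `M = s I - B` with `B ≥ 0` and `s ≥ ρ(B)`. -/
def IsMMatrix {ι : Type*} [Fintype ι] [DecidableEq ι] (M : Matrix ι ι ℝ) : Prop :=
  ∃ (s : ℝ) (B : Matrix ι ι ℝ), Nonneg B ∧ M = s • (1 : Matrix ι ι ℝ) - B ∧ rho B ≤ s

/-- Singular `M`-matrix: `M = s I - B` with `B ≥ 0` and `s = ρ(B)`. -/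
def IsSingularMMatrix {ι : Type*} [Fintype ι] [DecidableEq ι] (M : Matrix ι ι ℝ) : Prop :=
  ∃ (s : ℝ) (B : Matrix ι ι ℝ), Nonneg B ∧ M = s • (1 : Matrix ι ι ℝ) - B ∧ s = rho B

/-- Nonsingular `M`-matrix: `M = s I - B` with `B ≥ 0` and `s > ρ(B)`. -/
def IsNonsingularMMatrix {ι : Type*} [Fintype ι] [DecidableEq ι] (M : Matrix ι ι ℝ) : Prop :=
  ∃ (s : ℝ) (B : Matrix ι ι ℝ), Nonneg B ∧ M = s • (1 : Matrix ι ι ℝ) - B ∧ rho B < s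

/-- Regular `M`-matrix: an `M`-matrix `M` with `M v ≥ 0` for some `v > 0` (entrywise). -/
def IsRegularMMatrix {ι : Type*} [Fintype ι] [DecidableEq ι] (M : Matrix ι ι ℝ) : Prop :=
  IsMMatrix M ∧ ∃ v : ι → ℝ, (∀ i, 0 < v i) ∧ ∀ i, 0 ≤ M.mulVec v i

/-- The block matrix `K = [[D, -C], [-B, A]]`. -/
def blockK {n m : ℕ} (A : Matrix (Fin m) (Fin m) ℝ) (B : Matrix (Fin m) (Fin n) ℝ)
    (C : Matrix (Fin n) (Fin m) ℝ) (D : Matrix (Fin n) (Fin n) ℝ) :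
    Matrix (Fin n ⊕ Fin m) (Fin n ⊕ Fin m) ℝ :=
  Matrix.fromBlocks D (-C) (-B) A

/-- The block matrix `H = diag(I_n, -I_m) K`. -/
def blockH {n m : ℕ} (A : Matrix (Fin m) (Fin m) ℝ) (B : Matrix (Fin m) (Fin n) ℝ)
    (C : Matrix (Fin n) (Fin m) ℝ) (D : Matrix (Fin n) (Fin n) ℝ) :
    Matrix (Fin n ⊕ Fin m) (Fin n ⊕ Fin m) ℝ :=
  Matrix.fromBlocks 1 0 0 (-1) * blockK A B C D

/-- `X` is an (entrywise) nonnegative solution of `X C X - X D - A X + B = 0`.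
The dual equation `Y B Y - Y A - D Y + C = 0` is the same one for the data `(D, C, B, A)`. -/
def IsNonnegSolution {n m : ℕ} (A : Matrix (Fin m) (Fin m) ℝ) (B : Matrix (Fin m) (Fin n) ℝ)
    (C : Matrix (Fin n) (Fin m) ℝ) (D : Matrix (Fin n) (Fin n) ℝ)
    (X : Matrix (Fin m) (Fin n) ℝ) : Prop :=
  Nonneg X ∧ X * C * X - X * D - A * X + B = 0

/-- `X` is the minimal nonnegative solution of `X C X - X D - A X + B = 0`: a nonnegative
solution lying entrywise below every nonnegative solution. -/
def IsMinNonnegSolution {n m : ℕ} (A : Matrix (Fin m) (Fin m) ℝ) (B : Matrix (Fin m) (Fin n) ℝ)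
    (C : Matrix (Fin n) (Fin m) ℝ) (D : Matrix (Fin n) (Fin n) ℝ)
    (X : Matrix (Fin m) (Fin n) ℝ) : Prop :=
  IsNonnegSolution A B C D X ∧ ∀ Y, IsNonnegSolution A B C D Y → ∀ i j, X i j ≤ Y i j

end MRiccati

namespace MRiccati

open Filter Topology Matrix

/-! Put `w = (w₁, w₂) > 0` with `K w ≥ 0`, `R = D - CΦ`, `S = A - BΨ`. Fixed-point iteration from
`0` gives minimal solutions with `Φ w₁ ≤ w₂` and `Ψ w₂ ≤ w₁` (`exists_least_supersolution`). Hence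
`ΦΨ w₂ ≤ w₂`, and `1 - ΦΨ` is a nonsingular M-matrix as soon as its determinant is nonzero
(`rho_lt_one`); `1 - ΨΦ` has the same determinant.

Suppose the determinant vanishes. On `ker (1 - ΦΨ)` an eigenvalue `μ` of `S` yields the eigenvalue
`-μ` of `R`; both spectra lie in discs of the right half-plane that meet the imaginary axis only at
`0`, so `μ = 0` and `R`, `S` are both singular (`det_eq_zero_and_det_eq_zero`). Since `χ_H = χ_R
χ_{-S}` (`charpoly_blockH`), `0` is at least a double root of `χ_H`. The kernel of `H` is a line, so
its vector `v` has the form `H y`. As `(u₁, -u₂)` annihilates `H` from the left, `u₁ᵀv₁ - u₂ᵀv₂ =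
0`, a contradiction. -/

theorem Nonneg.mul {ι κ l : Type*} [Fintype κ] {X : Matrix ι κ ℝ} {Y : Matrix κ l ℝ}
    (hX : Nonneg X) (hY : Nonneg Y) : Nonneg (X * Y) := fun i j =>
  Finset.sum_nonneg fun k _ => mul_nonneg (hX i k) (hY k j)

theorem mul_le_mul_entry {ι κ l : Type*} [Fintype κ] {X X' : Matrix ι κ ℝ} {Y Y' : Matrix κ l ℝ}
    (hX' : Nonneg X') (hY : Nonneg Y) (h : ∀ i j, X i j ≤ X' i j) (h' : ∀ i j, Y i j ≤ Y' i j)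
    (i : ι) (j : l) : (X * Y) i j ≤ (X' * Y') i j :=
  Finset.sum_le_sum fun k _ => mul_le_mul (h i k) (h' k j) (hY k j) (hX' i k)

theorem Nonneg.mulVec_mono {ι κ : Type*} [Fintype κ] {X : Matrix ι κ ℝ} (hX : Nonneg X)
    {x y : κ → ℝ} (h : ∀ k, x k ≤ y k) (i : ι) : (X *ᵥ x) i ≤ (X *ᵥ y) i :=
  Finset.sum_le_sum fun k _ => mul_le_mul_of_nonneg_left (h k) (hX i k)

theorem Nonneg.mulVec_nonneg {ι κ : Type*} [Fintype κ] {X : Matrix ι κ ℝ} (hX : Nonneg X)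
    {x : κ → ℝ} (h : ∀ k, 0 ≤ x k) (i : ι) : 0 ≤ (X *ᵥ x) i :=
  Finset.sum_nonneg fun k _ => mul_nonneg (hX i k) (h k)

/-- The negative of the off-diagonal part of a square matrix. -/
def negOffDiag {ι : Type*} [DecidableEq ι] (M : Matrix ι ι ℝ) : Matrix ι ι ℝ :=
  diagonal M.diag - M

theorem nonneg_negOffDiag {ι : Type*} [DecidableEq ι] {M : Matrix ι ι ℝ}
    (h : ∀ i j, i ≠ j → M i j ≤ 0) : Nonneg (negOffDiag M) := by
  intro i j
  by_cases hij : i = j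
  · subst hij; simp [negOffDiag]
  · simpa [negOffDiag, hij] using h i j hij

theorem mulVec_eq_diag_sub {ι : Type*} [Fintype ι] [DecidableEq ι] (M : Matrix ι ι ℝ) (x : ι → ℝ)
    (i : ι) : (M *ᵥ x) i = M i i * x i - (negOffDiag M *ᵥ x) i := by
  simp [negOffDiag, sub_mulVec, mulVec_diagonal]

/-! ### Minimal solutions by monotone iteration -/

section Iteration

variable {n m : ℕ} {A : Matrix (Fin m) (Fin m) ℝ} {B : Matrix (Fin m) (Fin n) ℝ}
  {C : Matrix (Fin n) (Fin m) ℝ} {D : Matrix (Fin n) (Fin n) ℝ}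

/-- The monotone part of the Riccati operator. -/
def riccatiPart (A : Matrix (Fin m) (Fin m) ℝ) (B : Matrix (Fin m) (Fin n) ℝ)
    (C : Matrix (Fin n) (Fin m) ℝ) (D : Matrix (Fin n) (Fin n) ℝ)
    (X : Matrix (Fin m) (Fin n) ℝ) : Matrix (Fin m) (Fin n) ℝ :=
  X * C * X + X * negOffDiag D + negOffDiag A * X + B

theorem riccati_apply (X : Matrix (Fin m) (Fin n) ℝ) (i : Fin m) (j : Fin n) :
    (X * C * X - X * D - A * X + B) i j =
      riccatiPart A B C D X i j - X i j * (A i i + D j j) := by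
  simp only [riccatiPart, negOffDiag, Matrix.mul_sub, Matrix.sub_mul, Matrix.add_apply,
    Matrix.sub_apply, mul_diagonal, diagonal_mul, diag_apply]
  ring

/-- The fixed-point iteration for the Riccati equation. -/
noncomputable def riccatiStep (A : Matrix (Fin m) (Fin m) ℝ) (B : Matrix (Fin m) (Fin n) ℝ)
    (C : Matrix (Fin n) (Fin m) ℝ) (D : Matrix (Fin n) (Fin n) ℝ)
    (X : Matrix (Fin m) (Fin n) ℝ) : Matrix (Fin m) (Fin n) ℝ :=
  Matrix.of fun i j => riccatiPart A B C D X i j / (A i i + D j j)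

theorem riccatiPart_mono (hC : Nonneg C)
    (hA : ∀ i j, i ≠ j → A i j ≤ 0) (hD : ∀ i j, i ≠ j → D i j ≤ 0)
    {X Y : Matrix (Fin m) (Fin n) ℝ} (hX : Nonneg X) (h : ∀ i j, X i j ≤ Y i j) (i j) :
    riccatiPart A B C D X i j ≤ riccatiPart A B C D Y i j := by
  have hY : Nonneg Y := fun i j => (hX i j).trans (h i j)
  have hNA := nonneg_negOffDiag hA
  have hND := nonneg_negOffDiag hD
  have e1 := mul_le_mul_entry (hY.mul hC) hX
    (mul_le_mul_entry hY hC h fun _ _ => le_rfl) h i j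
  have e2 := mul_le_mul_entry hY hND h (fun _ _ => le_rfl) i j
  have e3 := mul_le_mul_entry hNA hX (fun _ _ => le_rfl) h i j
  simp only [riccatiPart, Matrix.add_apply]
  linarith

theorem riccatiStep_mono (hC : Nonneg C)
    (hA : ∀ i j, i ≠ j → A i j ≤ 0) (hD : ∀ i j, i ≠ j → D i j ≤ 0)
    (had : ∀ i j, 0 < A i i + D j j)
    {X Y : Matrix (Fin m) (Fin n) ℝ} (hX : Nonneg X) (h : ∀ i j, X i j ≤ Y i j) (i j) :
    riccatiStep A B C D X i j ≤ riccatiStep A B C D Y i j :=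
  div_le_div_of_nonneg_right (riccatiPart_mono hC hA hD hX h i j) (had i j).le

theorem continuous_riccatiStep : Continuous (riccatiStep A B C D) := by
  refine continuous_matrix fun i j => ?_
  simp only [riccatiStep, riccatiPart, Matrix.of_apply]
  refine Continuous.div_const ?_ _
  exact Continuous.matrix_elem (by fun_prop) i j

/-- Nonnegative matrices on which the iteration increases and which are bounded by `w`. -/
structure IterBound (A : Matrix (Fin m) (Fin m) ℝ) (B : Matrix (Fin m) (Fin n) ℝ)
    (C : Matrix (Fin n) (Fin m) ℝ) (D : Matrix (Fin n) (Fin n) ℝ) (w₁ : Fin n → ℝ)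
    (w₂ : Fin m → ℝ) (X : Matrix (Fin m) (Fin n) ℝ) : Prop where
  nonneg : Nonneg X
  bound : ∀ i, (X *ᵥ w₁) i ≤ w₂ i
  zero : ∀ i, A i i = 0 → ∀ j, X i j = 0
  le_step : ∀ i j, X i j ≤ riccatiStep A B C D X i j

theorem diag_nonneg_of_mulVec_nonneg {ι : Type*} [Fintype ι] [DecidableEq ι] {M : Matrix ι ι ℝ}
    (hM : ∀ i j, i ≠ j → M i j ≤ 0) {w : ι → ℝ} (hw : ∀ i, 0 < w i) {i : ι}
    (h : 0 ≤ (M *ᵥ w) i) : 0 ≤ M i i := by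
  rw [mulVec_eq_diag_sub] at h
  have := (nonneg_negOffDiag hM).mulVec_nonneg (fun k => (hw k).le) i
  exact nonneg_of_mul_nonneg_left (by linarith : 0 ≤ M i i * w i) (hw i)

theorem eq_zero_of_mulVec_eq_zero {ι κ : Type*} [Fintype κ] {X : Matrix ι κ ℝ} (hX : Nonneg X)
    {w : κ → ℝ} (hw : ∀ i, 0 < w i) {i : ι} (h : (X *ᵥ w) i = 0) (j : κ) : X i j = 0 := by
  have := (Finset.sum_eq_zero_iff_of_nonneg
    (fun k _ => mul_nonneg (hX i k) (hw k).le)).1 h j (Finset.mem_univ j)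
  exact (mul_eq_zero.1 this).resolve_right (hw j).ne'

/-- Let `Z` be the new iterate, and let `A_d`, `D_d` be the diagonal parts. Then `A_d Z + Z D_d =
riccatiPart X`, and `X w₁ ≤ w₂` bounds `riccatiPart X w₁` by `X D_d w₁ + A_d w₂`. Since `X ≤ Z`, the
`D_d` terms cancel and leave `A_d Z w₁ ≤ A_d w₂`. Rows with `A i i = 0` cannot be divided out; the
field `zero` handles them. -/
theorem IterBound.step (hB : Nonneg B) (hC : Nonneg C)
    (hA : ∀ i j, i ≠ j → A i j ≤ 0) (hD : ∀ i j, i ≠ j → D i j ≤ 0)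
    (had : ∀ i j, 0 < A i i + D j j) {w₁ : Fin n → ℝ} {w₂ : Fin m → ℝ}
    (hw₁ : ∀ i, 0 < w₁ i) (hw₂ : ∀ i, 0 < w₂ i)
    (h₁ : ∀ i, (C *ᵥ w₂) i ≤ (D *ᵥ w₁) i) (h₂ : ∀ i, (B *ᵥ w₁) i ≤ (A *ᵥ w₂) i)
    {X : Matrix (Fin m) (Fin n) ℝ} (h : IterBound A B C D w₁ w₂ X) :
    IterBound A B C D w₁ w₂ (riccatiStep A B C D X) := by
  have hNA := nonneg_negOffDiag hA
  have hND := nonneg_negOffDiag hD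
  have hA0 : ∀ i, 0 ≤ A i i := fun i => diag_nonneg_of_mulVec_nonneg hA hw₂
    ((hB.mulVec_nonneg (fun k => (hw₁ k).le) i).trans (h₂ i))
  have hD0 : ∀ i, 0 ≤ D i i := fun i => diag_nonneg_of_mulVec_nonneg hD hw₁
    ((hC.mulVec_nonneg (fun k => (hw₂ k).le) i).trans (h₁ i))
  have hnn : Nonneg (riccatiStep A B C D X) := fun i j => (h.nonneg i j).trans (h.le_step i j)
  have hzero : ∀ i, A i i = 0 → ∀ j, riccatiStep A B C D X i j = 0 := by
    intro i hi j
    -- With a zero diagonal entry, this row reads `B w₁ + negOffDiag A w₂ ≤ 0`, which forces both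
    -- nonnegative rows to vanish.
    have e := h₂ i
    rw [mulVec_eq_diag_sub, hi, zero_mul] at e
    have e1 := hB.mulVec_nonneg (fun k => (hw₁ k).le) i
    have e2 := hNA.mulVec_nonneg (fun k => (hw₂ k).le) i
    have hBi := eq_zero_of_mulVec_eq_zero hB hw₁ (i := i) (by linarith)
    have hAi := eq_zero_of_mulVec_eq_zero hNA hw₂ (i := i) (by linarith)
    have hXi := h.zero i hi
    simp [riccatiStep, riccatiPart, Matrix.mul_apply, hBi, hAi, hXi]
  refine ⟨hnn, fun i => ?_, hzero, riccatiStep_mono hC hA hD had h.nonneg h.le_step⟩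
  rcases (hA0 i).eq_or_lt with hi | hi
  · have : (riccatiStep A B C D X *ᵥ w₁) i = 0 := by
      simp [mulVec, dotProduct, hzero i hi.symm]
    rw [this]; exact (hw₂ i).le
  have key : (riccatiPart A B C D X *ᵥ w₁) i ≤ (X *ᵥ fun j => D j j * w₁ j) i + A i i * w₂ i := by
    have e1 : riccatiPart A B C D X *ᵥ w₁ = X *ᵥ (C *ᵥ (X *ᵥ w₁) + negOffDiag D *ᵥ w₁)
        + negOffDiag A *ᵥ (X *ᵥ w₁) + B *ᵥ w₁ := by
      simp [riccatiPart, add_mulVec, mulVec_add, mulVec_mulVec, Matrix.mul_assoc]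
    have e2 := h.nonneg.mulVec_mono (x := C *ᵥ (X *ᵥ w₁) + negOffDiag D *ᵥ w₁)
      (y := fun j => D j j * w₁ j) (fun k => by
        have := hC.mulVec_mono h.bound k
        have := h₁ k
        have := mulVec_eq_diag_sub D w₁ k
        simp only [Pi.add_apply]
        linarith) i
    have e3 := hNA.mulVec_mono h.bound i
    have e4 := h₂ i
    have e5 := mulVec_eq_diag_sub A w₂ i
    rw [e1]
    simp only [Pi.add_apply]
    linarith
  have e6 : (riccatiPart A B C D X *ᵥ w₁) i =
      A i i * (riccatiStep A B C D X *ᵥ w₁) i +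
        (riccatiStep A B C D X *ᵥ fun j => D j j * w₁ j) i := by
    simp only [mulVec, dotProduct, Finset.mul_sum, ← Finset.sum_add_distrib]
    refine Finset.sum_congr rfl fun j _ => ?_
    have : riccatiPart A B C D X i j = riccatiStep A B C D X i j * (A i i + D j j) := by
      simp only [riccatiStep, Matrix.of_apply]
      rw [div_mul_cancel₀ _ (had i j).ne']
    rw [this]; ring
  have e7 : (X *ᵥ fun j => D j j * w₁ j) i ≤
      (riccatiStep A B C D X *ᵥ fun j => D j j * w₁ j) i := by
    simp only [mulVec, dotProduct]
    exact Finset.sum_le_sum fun j _ => mul_le_mul_of_nonneg_right (h.le_step i j)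
      (mul_nonneg (hD0 j) (hw₁ j).le)
  exact le_of_mul_le_mul_left (by linarith) hi

theorem entry_le_of_mulVec_le {ι κ : Type*} [Fintype κ] {X : Matrix ι κ ℝ} (hX : Nonneg X)
    {w : κ → ℝ} (hw : ∀ i, 0 < w i) {b : ℝ} {i : ι} (h : (X *ᵥ w) i ≤ b) (j : κ) :
    X i j ≤ b / w j := by
  rw [le_div_iff₀ (hw j)]
  exact (Finset.single_le_sum (f := fun k => X i k * w k)
    (fun k _ => mul_nonneg (hX i k) (hw k).le) (Finset.mem_univ j)).trans h

/-- The iterates from `0` increase and stay below `w₂ i / w₁ j`; their limit is a fixed point by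
continuity. A supersolution satisfies `riccatiStep Y ≤ Y`, so it dominates every iterate. Minimality
among supersolutions, not only solutions, allows comparison between different `B`, `C`. -/
theorem exists_least_supersolution (hB : Nonneg B) (hC : Nonneg C)
    (hA : ∀ i j, i ≠ j → A i j ≤ 0) (hD : ∀ i j, i ≠ j → D i j ≤ 0)
    (had : ∀ i j, 0 < A i i + D j j) {w₁ : Fin n → ℝ} {w₂ : Fin m → ℝ}
    (hw₁ : ∀ i, 0 < w₁ i) (hw₂ : ∀ i, 0 < w₂ i)
    (h₁ : ∀ i, (C *ᵥ w₂) i ≤ (D *ᵥ w₁) i) (h₂ : ∀ i, (B *ᵥ w₁) i ≤ (A *ᵥ w₂) i) :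
    ∃ X, IsNonnegSolution A B C D X ∧ (∀ i, (X *ᵥ w₁) i ≤ w₂ i) ∧
      ∀ Y, Nonneg Y → (∀ i j, (Y * C * Y - Y * D - A * Y + B) i j ≤ 0) →
        ∀ i j, X i j ≤ Y i j := by
  let X : ℕ → Matrix (Fin m) (Fin n) ℝ := fun k => (riccatiStep A B C D)^[k] 0
  have hsucc : ∀ k, X (k + 1) = riccatiStep A B C D (X k) := fun k =>
    Function.iterate_succ_apply' _ _ _
  have hI : ∀ k, IterBound A B C D w₁ w₂ (X k) := by
    intro k
    induction k with
    | zero =>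
      refine ⟨fun _ _ => le_rfl, fun i => ?_, fun _ _ _ => rfl, fun i j => ?_⟩
      · simpa [X] using (hw₂ i).le
      · simpa [X, riccatiStep, riccatiPart] using div_nonneg (hB i j) (had i j).le
    | succ k ih => rw [hsucc]; exact ih.step hB hC hA hD had hw₁ hw₂ h₁ h₂
  have hmono : ∀ i j, Monotone fun k => X k i j := fun i j =>
    monotone_nat_of_le_succ fun k => by rw [hsucc]; exact (hI k).le_step i j
  have hlim : ∀ i j, ∃ l, Tendsto (fun k => X k i j) atTop (𝓝 l) := fun i j =>
    ⟨_, tendsto_atTop_ciSup (hmono i j)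
      ⟨w₂ i / w₁ j, by
        rintro _ ⟨k, rfl⟩
        exact entry_le_of_mulVec_le (hI k).nonneg hw₁ ((hI k).bound i) j⟩⟩
  choose L hL using hlim
  have hXL : Tendsto X atTop (𝓝 (Matrix.of L)) :=
    tendsto_pi_nhds.2 fun i => tendsto_pi_nhds.2 fun j => hL i j
  have hfix : riccatiStep A B C D (Matrix.of L) = Matrix.of L := by
    refine tendsto_nhds_unique ((continuous_riccatiStep.tendsto _).comp hXL) ?_
    refine ((tendsto_add_atTop_iff_nat 1).2 hXL).congr fun k => ?_
    rw [hsucc]; rfl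
  refine ⟨Matrix.of L, ⟨fun i j => ge_of_tendsto' (hL i j) fun k => (hI k).nonneg i j, ?_⟩,
    fun i => ?_, fun Y hY hs i j => ?_⟩
  · ext i j
    rw [riccati_apply, Matrix.zero_apply, sub_eq_zero]
    conv_rhs => rw [← hfix]
    simp only [riccatiStep, Matrix.of_apply]
    rw [div_mul_cancel₀ _ (had i j).ne']
  · have hc : Continuous fun Z : Matrix (Fin m) (Fin n) ℝ => (Z *ᵥ w₁) i :=
      (continuous_apply i).comp (Continuous.matrix_mulVec continuous_id continuous_const)
    exact le_of_tendsto' ((hc.tendsto _).comp hXL) fun k => (hI k).bound i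
  · refine le_of_tendsto' (hL i j) fun k => ?_
    induction k generalizing i j with
    | zero => exact hY i j
    | succ k ih =>
      rw [hsucc]
      refine (riccatiStep_mono hC hA hD had (hI k).nonneg ih i j).trans ?_
      have := hs i j
      rw [riccati_apply] at this
      rw [riccatiStep, Matrix.of_apply, div_le_iff₀ (had i j)]
      linarith

end Iteration

/-! ### Spectral bounds from positive test vectors -/

section Spectral

variable {ι : Type*} [Fintype ι]

/-- A weighted Gershgorin estimate. -/
theorem exists_norm_le_of_mulVec_le {N : Matrix ι ι ℝ} (hN : Nonneg N) {z b : ι → ℝ}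
    (hz : ∀ i, 0 < z i) (hb : ∀ i, (N *ᵥ z) i ≤ b i * z i) {d x : ι → ℂ} (hx : x ≠ 0)
    (h : ∀ i, d i * x i = ∑ j, (N i j : ℂ) * x j) : ∃ i, ‖d i‖ ≤ b i := by
  obtain ⟨k, hk⟩ := Function.ne_iff.1 hx
  have : Nonempty ι := ⟨k⟩
  -- The row that maximizes `‖x i‖ / z i` gives the estimate.
  obtain ⟨i, hi⟩ := Finite.exists_max fun i => ‖x i‖ / z i
  have hxi : 0 < ‖x i‖ / z i := (div_pos (norm_pos_iff.2 hk) (hz k)).trans_le (hi k)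
  refine ⟨i, le_of_mul_le_mul_right ?_ (mul_pos hxi (hz i))⟩
  calc ‖d i‖ * (‖x i‖ / z i * z i) = ‖d i * x i‖ := by
        rw [div_mul_cancel₀ _ (hz i).ne', norm_mul]
    _ = ‖∑ j, (N i j : ℂ) * x j‖ := by rw [h]
    _ ≤ ∑ j, N i j * (‖x i‖ / z i * z j) := by
        refine norm_sum_le_of_le _ fun j _ => ?_
        rw [norm_mul, Complex.norm_real, Real.norm_of_nonneg (hN i j)]
        exact mul_le_mul_of_nonneg_left ((div_le_iff₀ (hz j)).1 (hi j)) (hN i j)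
    _ = ‖x i‖ / z i * (N *ᵥ z) i := by
        simp only [mulVec, dotProduct, Finset.mul_sum]
        exact Finset.sum_congr rfl fun j _ => by ring
    _ ≤ ‖x i‖ / z i * (b i * z i) := mul_le_mul_of_nonneg_left (hb i) hxi.le
    _ = b i * (‖x i‖ / z i * z i) := by ring

/-- Minimum principle: at an index `k` minimizing `x / w`, a negative minimum would give `x k ≤ (P
x) k`, hence `x k ≥ s (P x) k ≥ s x k`, impossible for `x k < 0` and `s < 1`. -/
theorem nonneg_of_smul_mulVec_le {P : Matrix ι ι ℝ} (hP : Nonneg P) {w : ι → ℝ}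
    (hw : ∀ i, 0 < w i) (hPw : ∀ i, (P *ᵥ w) i ≤ w i) {s : ℝ} (hs0 : 0 ≤ s) (hs1 : s < 1)
    {x : ι → ℝ} (hx : ∀ i, s * (P *ᵥ x) i ≤ x i) (i : ι) : 0 ≤ x i := by
  have : Nonempty ι := ⟨i⟩
  obtain ⟨k, hk⟩ := Finite.exists_min fun i => x i / w i
  suffices h : 0 ≤ x k / w k by
    have := h.trans (hk i)
    rw [le_div_iff₀ (hw i)] at this
    simpa using this
  by_contra! hneg
  have e1 : x k / w k * (P *ᵥ w) k ≤ (P *ᵥ x) k := by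
    simp only [mulVec, dotProduct, Finset.mul_sum]
    refine Finset.sum_le_sum fun j _ => ?_
    have := mul_le_mul_of_nonneg_left ((le_div_iff₀ (hw j)).1 (hk j)) (hP k j)
    linarith
  have e2 : x k / w k * w k ≤ x k / w k * (P *ᵥ w) k :=
    mul_le_mul_of_nonpos_left (hPw k) hneg.le
  rw [div_mul_cancel₀ _ (hw k).ne'] at e2
  have e3 := mul_le_mul_of_nonneg_left (e2.trans e1) hs0
  have e4 := hx k
  have e5 : x k < 0 := by
    have := mul_neg_of_neg_of_pos hneg (hw k)
    rwa [div_mul_cancel₀ _ (hw k).ne'] at this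
  nlinarith

variable [DecidableEq ι]

theorem det_one_sub_smul_ne_zero {P : Matrix ι ι ℝ} (hP : Nonneg P) {w : ι → ℝ}
    (hw : ∀ i, 0 < w i) (hPw : ∀ i, (P *ᵥ w) i ≤ w i) {s : ℝ} (hs0 : 0 ≤ s) (hs1 : s < 1) :
    (1 - s • P).det ≠ 0 := by
  intro h
  obtain ⟨v, hv0, hv⟩ := Matrix.exists_mulVec_eq_zero_iff.2 h
  have hv' : ∀ i, v i = s * (P *ᵥ v) i := fun i => by
    have := congrFun hv i
    simp only [sub_mulVec, one_mulVec, smul_mulVec, Pi.sub_apply, Pi.smul_apply, smul_eq_mul,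
      Pi.zero_apply] at this
    linarith
  apply hv0
  ext i
  have h1 := nonneg_of_smul_mulVec_le hP hw hPw hs0 hs1 (x := v) (fun i => (hv' i).ge) i
  have h2 := nonneg_of_smul_mulVec_le hP hw hPw hs0 hs1 (x := -v) (fun i => by
    rw [mulVec_neg, Pi.neg_apply, Pi.neg_apply, mul_neg, ← hv']) i
  simp only [Pi.neg_apply, Pi.zero_apply] at h2 ⊢
  linarith

/-- For `s < 1` the vector `x = (1 - sP)⁻¹ w` is nonnegative, so `x = w + s P x ≥ w`. Invertibility
of `1 - P` makes the inverse continuous at `s = 1`, and the bound passes to the limit. -/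
theorem le_inv_one_sub_mulVec {P : Matrix ι ι ℝ} (hP : Nonneg P) {w : ι → ℝ}
    (hw : ∀ i, 0 < w i) (hPw : ∀ i, (P *ᵥ w) i ≤ w i) (hdet : (1 - P).det ≠ 0) (i : ι) :
    w i ≤ ((1 - P)⁻¹ *ᵥ w) i := by
  let g : ℝ → ℝ := fun s => ((1 - s • P).det)⁻¹ * ((1 - s • P).adjugate *ᵥ w) i
  have hg : ∀ s, g s = ((1 - s • P)⁻¹ *ᵥ w) i := fun s => by
    simp [g, inv_def, smul_mulVec]
  have hcont : ContinuousAt g 1 := by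
    have hM : Continuous fun s : ℝ => 1 - s • P := by fun_prop
    refine ContinuousAt.mul (ContinuousAt.inv₀ hM.matrix_det.continuousAt (by simpa)) ?_
    exact ((continuous_apply i).comp
      (hM.matrix_adjugate.matrix_mulVec continuous_const)).continuousAt
  have h1 : g 1 = ((1 - P)⁻¹ *ᵥ w) i := by rw [hg, one_smul]
  rw [← h1]
  have hlim : Tendsto g (𝓝[<] 1) (𝓝 (g 1)) := hcont.tendsto.mono_left nhdsWithin_le_nhds
  refine ge_of_tendsto hlim ?_
  filter_upwards [Ioo_mem_nhdsLT (zero_lt_one : (0 : ℝ) < 1)] with s hs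
  rw [hg]
  set x := (1 - s • P)⁻¹ *ᵥ w
  have hx : ∀ i, x i - s * (P *ᵥ x) i = w i := fun i => by
    have hu := (det_one_sub_smul_ne_zero hP hw hPw hs.1.le hs.2).isUnit
    have : (1 - s • P) *ᵥ x = w := by
      simp only [x, mulVec_mulVec, mul_nonsing_inv _ hu, one_mulVec]
    have := congrFun this i
    simpa [sub_mulVec, smul_mulVec] using this
  have hx0 := nonneg_of_smul_mulVec_le hP hw hPw hs.1.le hs.2 (x := x) fun i => by
    have := hx i; have := hw i; linarith
  have := mul_nonneg hs.1.le (hP.mulVec_nonneg hx0 i)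
  have := hx i
  linarith

/-- The weak inequality `P w ≤ w` is upgraded to a strict one: `z = (1 - P)⁻¹ w ≥ w > 0` satisfies
`P z = z - w ≤ (1 - δ) z`, and the weighted Gershgorin estimate bounds every eigenvalue by `1 - δ`.
-/
theorem rho_lt_one {P : Matrix ι ι ℝ} (hP : Nonneg P) {w : ι → ℝ}
    (hw : ∀ i, 0 < w i) (hPw : ∀ i, (P *ᵥ w) i ≤ w i) (hdet : (1 - P).det ≠ 0) :
    rho P < 1 := by
  set z := (1 - P)⁻¹ *ᵥ w with hzdef
  have hz : ∀ i, 0 < z i := fun i => (hw i).trans_le (le_inv_one_sub_mulVec hP hw hPw hdet i)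
  have hPz : ∀ i, (P *ᵥ z) i = z i - w i := fun i => by
    have : (1 - P) *ᵥ z = w := by
      simp only [z, mulVec_mulVec, mul_nonsing_inv _ hdet.isUnit, one_mulVec]
    have := congrFun this i
    simp only [sub_mulVec, one_mulVec, Pi.sub_apply] at this
    linarith
  obtain ⟨δ, ⟨hδ0, hδ1⟩, hδ⟩ : ∃ δ : ℝ, δ ∈ Set.Ioo (0 : ℝ) 1 ∧ ∀ i, δ * z i < w i := by
    have h1 : ∀ᶠ δ : ℝ in 𝓝[>] 0, ∀ i, δ * z i < w i := by
      refine eventually_all.2 fun i => ?_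
      have : Tendsto (fun δ : ℝ => δ * z i) (𝓝[>] 0) (𝓝 (0 * z i)) :=
        (tendsto_id.mul_const _).mono_left nhdsWithin_le_nhds
      rw [zero_mul] at this
      exact this.eventually_lt_const (hw i)
    have h2 : ∀ᶠ δ : ℝ in 𝓝[>] 0, δ ∈ Set.Ioo (0 : ℝ) 1 := Ioo_mem_nhdsGT zero_lt_one
    exact (h2.and h1).exists
  refine lt_of_le_of_lt ?_ (by linarith : 1 - δ < 1)
  refine ENNReal.toReal_le_of_le_ofReal (by linarith) ?_
  refine iSup₂_le fun k hk => ?_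
  rw [← Matrix.spectrum_toLin', ← Module.End.hasEigenvalue_iff_mem_spectrum] at hk
  obtain ⟨x, hx⟩ := hk.exists_hasEigenvector
  have hxk : P.map (algebraMap ℝ ℂ) *ᵥ x = k • x := by
    rw [← Matrix.toLin'_apply]; exact hx.apply_eq_smul
  obtain ⟨i, hi⟩ := exists_norm_le_of_mulVec_le hP hz (b := fun _ => 1 - δ) (d := fun _ => k)
    (fun i => by rw [hPz]; have := hδ i; linarith) hx.2
    (fun i => (congrFun hxk i).symm)
  change ‖k‖ₑ ≤ _
  rw [← ofReal_norm]
  exact ENNReal.ofReal_le_ofReal hi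

theorem isNonsingularMMatrix_one_sub {P : Matrix ι ι ℝ} (hP : Nonneg P) {w : ι → ℝ}
    (hw : ∀ i, 0 < w i) (hPw : ∀ i, (P *ᵥ w) i ≤ w i) (hdet : (1 - P).det ≠ 0) :
    IsNonsingularMMatrix (1 - P) :=
  ⟨1, P, hP, by rw [one_smul], rho_lt_one hP hw hPw hdet⟩

/-- Eigenvalues of a `Z`-matrix `M` with `M w ≥ 0`, `w > 0` lie in a disc touching the imaginary
axis from the right. -/
theorem exists_normSq_le_of_eigenvector {M : Matrix ι ι ℝ} (hM : ∀ i j, i ≠ j → M i j ≤ 0)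
    {w : ι → ℝ} (hw : ∀ i, 0 < w i) (hMw : ∀ i, 0 ≤ (M *ᵥ w) i) {x : ι → ℂ} (hx : x ≠ 0) {μ : ℂ}
    (h : M.map (algebraMap ℝ ℂ) *ᵥ x = μ • x) :
    ∃ s : ℝ, 0 ≤ s ∧ Complex.normSq μ ≤ 2 * s * μ.re := by
  -- The eigenvalue equation with its diagonal term moved across gives `‖M i i - μ‖ ≤ M i i`;
  -- squaring this yields the claim with `s = M i i`.
  obtain ⟨i, hi⟩ := exists_norm_le_of_mulVec_le (nonneg_negOffDiag hM) hw
    (b := fun i => M i i) (d := fun i => M i i - μ)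
    (fun i => by have := hMw i; rw [mulVec_eq_diag_sub] at this; linarith) hx
    (fun i => by
      have h1 := congrFun h i
      have h2 : ((negOffDiag M).map (algebraMap ℝ ℂ) *ᵥ x) i
          = M i i * x i - (M.map (algebraMap ℝ ℂ) *ᵥ x) i := by
        rw [negOffDiag, Matrix.map_sub _ (map_sub _), sub_mulVec,
          Matrix.diagonal_map (map_zero _), Pi.sub_apply, mulVec_diagonal]
        rfl
      rw [h1] at h2
      change _ = ((negOffDiag M).map (algebraMap ℝ ℂ) *ᵥ x) i
      rw [h2, Pi.smul_apply, smul_eq_mul]; ring)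
  refine ⟨M i i, (norm_nonneg _).trans hi, ?_⟩
  have h3 : Complex.normSq (M i i - μ) ≤ M i i ^ 2 := by
    rw [Complex.normSq_eq_norm_sq]
    exact pow_le_pow_left₀ (norm_nonneg _) hi 2
  simp only [Complex.normSq_apply, Complex.sub_re, Complex.sub_im, Complex.ofReal_re,
    Complex.ofReal_im] at h3 ⊢
  nlinarith

end Spectral

/-! ### Block diagonalization of `H` and the degenerate case -/

section Blocks

variable {n m : ℕ} {A : Matrix (Fin m) (Fin m) ℝ} {B : Matrix (Fin m) (Fin n) ℝ}
  {C : Matrix (Fin n) (Fin m) ℝ} {D : Matrix (Fin n) (Fin n) ℝ}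
  {Φ : Matrix (Fin m) (Fin n) ℝ} {Ψ : Matrix (Fin n) (Fin m) ℝ}

theorem blockH_eq : blockH A B C D = fromBlocks D (-C) B (-A) := by
  simp [blockH, blockK, fromBlocks_multiply]

/-- The Riccati equations say that `H T = T diag(R, -S)` for `T = [[1, Ψ], [Φ, 1]]`, and `det T =
det (1 - ΦΨ)` can be cancelled. -/
theorem det_scalar_sub_blockH (hΦ : Φ * C * Φ - Φ * D - A * Φ + B = 0)
    (hΨ : Ψ * B * Ψ - Ψ * A - D * Ψ + C = 0) (hdet : (1 - Φ * Ψ).det ≠ 0) (z : ℝ) :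
    (scalar _ z - blockH A B C D).det =
      (scalar _ z - (D - C * Φ)).det * (scalar _ z - -(A - B * Ψ)).det := by
  have hz : (scalar (Fin n ⊕ Fin m) z : Matrix _ _ ℝ) =
      fromBlocks (scalar _ z) 0 0 (scalar _ z) := by
    simp only [scalar_apply, fromBlocks_diagonal]
    congr 1; ext i; cases i <;> rfl
  have hB : B = Φ * D + A * Φ - Φ * C * Φ := by
    rw [← sub_eq_zero, ← hΦ]; abel
  have hC : C = Ψ * A + D * Ψ - Ψ * B * Ψ := by
    rw [← sub_eq_zero, ← hΨ]; abel
  have hmul : (scalar _ z - blockH A B C D) * fromBlocks 1 Ψ Φ 1 =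
      fromBlocks 1 Ψ Φ 1 * fromBlocks (scalar _ z - (D - C * Φ)) 0 0
        (scalar _ z - -(A - B * Ψ)) := by
    have hH : scalar _ z - blockH A B C D =
        fromBlocks (scalar _ z - D) C (-B) (scalar _ z - -A) := by
      rw [hz, blockH_eq, sub_eq_add_neg, fromBlocks_neg, fromBlocks_add]
      simp [sub_eq_add_neg]
    rw [hH, fromBlocks_multiply, fromBlocks_multiply]
    have e1 : Φ * (scalar (Fin n) z) = scalar (Fin m) z * Φ := by
      ext i j; simp [scalar_apply, mul_comm]
    have e2 : Ψ * (scalar (Fin m) z) = scalar (Fin n) z * Ψ := by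
      ext i j; simp [scalar_apply, mul_comm]
    congr 1
    · simp only [Matrix.mul_one, Matrix.one_mul, Matrix.mul_zero, add_zero]
      abel
    · simp only [Matrix.mul_one, Matrix.mul_zero, Matrix.mul_add, Matrix.mul_sub, Matrix.sub_mul,
        sub_neg_eq_add, e2, zero_add, ← Matrix.mul_assoc]
      conv_lhs => rw [hC]
      abel
    · simp only [Matrix.mul_one, Matrix.mul_zero, Matrix.mul_sub, sub_neg_eq_add, e1, add_zero, Matrix.add_mul,
        ← Matrix.mul_assoc]
      conv_lhs => rw [hB]
      abel
    · simp only [Matrix.mul_one, Matrix.one_mul, Matrix.mul_zero, Matrix.neg_mul,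
        sub_neg_eq_add, zero_add]
      abel
  have hd := congrArg Matrix.det hmul
  rw [det_mul, det_mul, det_fromBlocks_zero₂₁, det_fromBlocks_one₁₁, mul_comm] at hd
  exact mul_left_cancel₀ hdet hd

theorem det_eq_zero_of_map_mulVec_eq_zero {ι : Type*} [Fintype ι] [DecidableEq ι]
    {M : Matrix ι ι ℝ} {x : ι → ℂ} (hx : x ≠ 0) (h : M.map (algebraMap ℝ ℂ) *ᵥ x = 0) :
    M.det = 0 := by
  have := Matrix.exists_mulVec_eq_zero_iff.1 ⟨x, hx, h⟩
  have h2 := RingHom.map_det (algebraMap ℝ ℂ) M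
  rw [RingHom.mapMatrix_apply, this] at h2
  simpa using h2

/-- The identity `i2` makes `ker (1 - ΦΨ)` invariant under `S`, so over `ℂ` it contains an
eigenvector `S x = μ x`. By `i1`, `y = Ψ x` satisfies `R y = -μ y`, and `Φ y = x` shows `y ≠ 0`. -/
theorem det_eq_zero_and_det_eq_zero (hΦ : Φ * C * Φ - Φ * D - A * Φ + B = 0)
    (hΨ : Ψ * B * Ψ - Ψ * A - D * Ψ + C = 0) (hdet : (1 - Φ * Ψ).det = 0)
    (hR : ∀ i j, i ≠ j → (D - C * Φ) i j ≤ 0) (hS : ∀ i j, i ≠ j → (A - B * Ψ) i j ≤ 0)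
    {w₁ : Fin n → ℝ} {w₂ : Fin m → ℝ} (hw₁ : ∀ i, 0 < w₁ i) (hw₂ : ∀ i, 0 < w₂ i)
    (hRw : ∀ i, 0 ≤ ((D - C * Φ) *ᵥ w₁) i) (hSw : ∀ i, 0 ≤ ((A - B * Ψ) *ᵥ w₂) i) :
    (D - C * Φ).det = 0 ∧ (A - B * Ψ).det = 0 := by
  let F := algebraMap ℝ ℂ
  set R := D - C * Φ with hRdef
  set S := A - B * Ψ with hSdef
  have hC : C = Ψ * A + D * Ψ - Ψ * B * Ψ := by
    rw [← sub_eq_zero, ← hΨ]; abel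
  have hB : B = Φ * D + A * Φ - Φ * C * Φ := by
    rw [← sub_eq_zero, ← hΦ]; abel
  have i1 : R * Ψ + Ψ * S = C * (1 - Φ * Ψ) := by
    simp only [hRdef, hSdef, Matrix.mul_sub, Matrix.sub_mul, Matrix.mul_one, ← Matrix.mul_assoc]
    conv_rhs => enter [1]; rw [hC]
    abel
  have i2 : (1 - Φ * Ψ) * S = (A - Φ * C) * (1 - Φ * Ψ) := by
    have i3 : Φ * R = B - A * Φ := by
      rw [hRdef, Matrix.mul_sub, ← Matrix.mul_assoc]
      conv_rhs => rw [hB]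
      abel
    have i4 : Φ * Ψ * S = Φ * (C * (1 - Φ * Ψ)) - (B - A * Φ) * Ψ := by
      rw [← i1, ← i3]
      simp only [Matrix.mul_add, Matrix.mul_assoc]; abel
    rw [Matrix.sub_mul, i4, hSdef]
    simp only [Matrix.mul_sub, Matrix.sub_mul, Matrix.mul_one, Matrix.one_mul, ← Matrix.mul_assoc]
    abel
  let V : Submodule ℂ (Fin m → ℂ) := LinearMap.ker (Matrix.toLin' ((1 - Φ * Ψ).map F))
  have hV : ∀ x, x ∈ V ↔ (1 - Φ * Ψ).map F *ᵥ x = 0 := fun x => by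
    rw [LinearMap.mem_ker, Matrix.toLin'_apply]
  have hmap : ∀ x ∈ V, Matrix.toLin' (S.map F) x ∈ V := by
    intro x hx
    rw [hV] at hx ⊢
    rw [Matrix.toLin'_apply, mulVec_mulVec, ← Matrix.map_mul, i2, Matrix.map_mul, ← mulVec_mulVec,
      hx, mulVec_zero]
  have : Nontrivial V := by
    have hd : ((1 - Φ * Ψ).map F).det = 0 := by
      have := RingHom.map_det F (1 - Φ * Ψ)
      rw [hdet, map_zero] at this
      exact this.symm
    obtain ⟨x, hx0, hx⟩ := Matrix.exists_mulVec_eq_zero_iff.2 hd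
    exact ⟨⟨⟨x, (hV x).2 hx⟩, 0, fun h => hx0 (congrArg Subtype.val h)⟩⟩
  obtain ⟨μ, hμ⟩ := Module.End.exists_eigenvalue ((Matrix.toLin' (S.map F)).restrict hmap)
  obtain ⟨⟨x, hxV⟩, hx⟩ := hμ.exists_hasEigenvector
  have hx0 : x ≠ 0 := fun h => hx.2 (Subtype.ext h)
  have hSx : S.map F *ᵥ x = μ • x := by
    have := congrArg Subtype.val hx.apply_eq_smul
    simpa using this
  rw [hV] at hxV
  set y := Ψ.map F *ᵥ x with hy
  have hΦy : Φ.map F *ᵥ y = x := by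
    rw [Matrix.map_sub _ (map_sub _), Matrix.map_one _ (map_zero _) (map_one _), sub_mulVec,
      one_mulVec, Matrix.map_mul, ← mulVec_mulVec, sub_eq_zero] at hxV
    exact hxV.symm
  have hy0 : y ≠ 0 := fun h => hx0 (by rw [← hΦy, h, mulVec_zero])
  have hRy : R.map F *ᵥ y = (-μ) • y := by
    have e : (R * Ψ + Ψ * S).map F *ᵥ x = 0 := by
      rw [i1, Matrix.map_mul, ← mulVec_mulVec, hxV, mulVec_zero]
    rw [Matrix.map_add _ (map_add _), add_mulVec, Matrix.map_mul, Matrix.map_mul,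
      ← mulVec_mulVec, ← mulVec_mulVec, hSx, mulVec_smul] at e
    rw [neg_smul]
    exact eq_neg_of_add_eq_zero_left e
  -- The two discs give `|μ|² ≤ 2 s Re μ` and `|μ|² ≤ -2 r Re μ`; whatever the sign of `Re μ`, one
  -- right-hand side is nonpositive.
  have hμ0 : μ = 0 := by
    obtain ⟨s, hs, h1⟩ := exists_normSq_le_of_eigenvector hS hw₂ hSw hx0 hSx
    obtain ⟨r, hr, h2⟩ := exists_normSq_le_of_eigenvector hR hw₁ hRw hy0 hRy
    rw [Complex.normSq_neg, Complex.neg_re] at h2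
    refine Complex.normSq_eq_zero.1 (le_antisymm ?_ (Complex.normSq_nonneg μ))
    rcases le_total 0 μ.re with h | h
    · nlinarith [mul_nonneg hr h]
    · nlinarith [mul_nonneg hs (neg_nonneg.2 h)]
  rw [hμ0] at hSx hRy
  rw [zero_smul] at hSx
  rw [neg_zero, zero_smul] at hRy
  exact ⟨det_eq_zero_of_map_mulVec_eq_zero hy0 hRy, det_eq_zero_of_map_mulVec_eq_zero hx0 hSx⟩

end Blocks

/-! ### Factorization of the characteristic polynomial by perturbation -/

section Limit

variable {n m : ℕ} {A : Matrix (Fin m) (Fin m) ℝ} {B : Matrix (Fin m) (Fin n) ℝ}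
  {C : Matrix (Fin n) (Fin m) ℝ} {D : Matrix (Fin n) (Fin n) ℝ}

theorem supersolution_of_le {B' : Matrix (Fin m) (Fin n) ℝ} {C' : Matrix (Fin n) (Fin m) ℝ}
    (hC : Nonneg C) (hBB' : ∀ i j, B i j ≤ B' i j) (hCC' : ∀ i j, C i j ≤ C' i j)
    {Y : Matrix (Fin m) (Fin n) ℝ} (hY : IsNonnegSolution A B' C' D Y) (i j) :
    (Y * C * Y - Y * D - A * Y + B) i j ≤ 0 := by
  have h := congrFun (congrFun hY.2 i) j
  have hC' : Nonneg C' := fun i j => (hC i j).trans (hCC' i j)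
  have e := mul_le_mul_entry (hY.1.mul hC') hY.1
    (mul_le_mul_entry hY.1 hC (fun _ _ => le_rfl) hCC') (fun _ _ => le_rfl) i j
  have e2 := hBB' i j
  simp only [Matrix.add_apply, Matrix.sub_apply, Matrix.zero_apply] at h ⊢
  linarith

/-- As the data increase, so do the solutions, which remain below `Φ`. Their limit solves the limit
equation, hence is at least `Φ` by minimality. -/
theorem tendsto_least_supersolution {Bk : ℕ → Matrix (Fin m) (Fin n) ℝ}
    {Ck : ℕ → Matrix (Fin n) (Fin m) ℝ} (hC : ∀ k, Nonneg (Ck k))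
    (hBmono : ∀ i j, Monotone fun k => Bk k i j) (hCmono : ∀ i j, Monotone fun k => Ck k i j)
    (hB : Tendsto Bk atTop (𝓝 B)) (hC' : Tendsto Ck atTop (𝓝 C))
    {X : ℕ → Matrix (Fin m) (Fin n) ℝ} (hX : ∀ k, IsNonnegSolution A (Bk k) (Ck k) D (X k))
    (hleast : ∀ k Y, Nonneg Y → (∀ i j, (Y * Ck k * Y - Y * D - A * Y + Bk k) i j ≤ 0) →
      ∀ i j, X k i j ≤ Y i j)
    {Φ : Matrix (Fin m) (Fin n) ℝ} (hΦ : IsMinNonnegSolution A B C D Φ) :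
    Tendsto X atTop (𝓝 Φ) := by
  have hB_le : ∀ k i j, Bk k i j ≤ B i j := fun k i j =>
    (hBmono i j).ge_of_tendsto (tendsto_pi_nhds.1 (tendsto_pi_nhds.1 hB i) j) k
  have hC_le : ∀ k i j, Ck k i j ≤ C i j := fun k i j =>
    (hCmono i j).ge_of_tendsto (tendsto_pi_nhds.1 (tendsto_pi_nhds.1 hC' i) j) k
  have hXΦ : ∀ k i j, X k i j ≤ Φ i j := fun k =>
    hleast k Φ hΦ.1.1 (supersolution_of_le (hC k) (hB_le k) (hC_le k) hΦ.1)
  have hmono : ∀ i j, Monotone fun k => X k i j := fun i j =>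
    monotone_nat_of_le_succ fun k => hleast k _ (hX (k + 1)).1
      (supersolution_of_le (hC k) (fun i j => hBmono i j k.le_succ)
        (fun i j => hCmono i j k.le_succ) (hX (k + 1))) i j
  have hlim : ∀ i j, ∃ l, Tendsto (fun k => X k i j) atTop (𝓝 l) := fun i j =>
    ⟨_, tendsto_atTop_ciSup (hmono i j) ⟨Φ i j, by rintro _ ⟨k, rfl⟩; exact hXΦ k i j⟩⟩
  choose L hL using hlim
  have hXL : Tendsto X atTop (𝓝 (Matrix.of L)) :=
    tendsto_pi_nhds.2 fun i => tendsto_pi_nhds.2 fun j => hL i j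
  have hsol : IsNonnegSolution A B C D (Matrix.of L) := by
    refine ⟨fun i j => ge_of_tendsto' (hL i j) fun k => (hX k).1 i j, ?_⟩
    have hc : Continuous fun p : Matrix (Fin m) (Fin n) ℝ × Matrix (Fin m) (Fin n) ℝ ×
        Matrix (Fin n) (Fin m) ℝ => p.1 * p.2.2 * p.1 - p.1 * D - A * p.1 + p.2.1 := by fun_prop
    refine tendsto_nhds_unique
      ((hc.tendsto (Matrix.of L, B, C)).comp (hXL.prodMk_nhds (hB.prodMk_nhds hC'))) ?_
    exact tendsto_const_nhds.congr fun k => (hX k).2.symm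
  have : Matrix.of L = Φ := by
    ext i j
    exact le_antisymm (le_of_tendsto' (hL i j) fun k => hXΦ k i j) (hΦ.2 _ hsol i j)
  rwa [← this]

theorem det_one_sub_ne_zero_of_mulVec_le {ι : Type*} [Fintype ι] [DecidableEq ι]
    {P : Matrix ι ι ℝ} (hP : Nonneg P) {w : ι → ℝ} (hw : ∀ i, 0 < w i) {t : ℝ} (ht0 : 0 < t)
    (ht1 : t < 1) (hPw : ∀ i, (P *ᵥ w) i ≤ t * w i) : (1 - P).det ≠ 0 := by
  have := det_one_sub_smul_ne_zero (P := t⁻¹ • P) (s := t)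
    (fun i j => mul_nonneg (inv_nonneg.2 ht0.le) (hP i j)) hw (fun i => by
      rw [smul_mulVec, Pi.smul_apply, smul_eq_mul, inv_mul_le_iff₀ ht0]; exact hPw i) ht0.le ht1
  rwa [smul_inv_smul₀ ht0.ne'] at this

/-- The similarity needs `det (1 - ΦΨ) ≠ 0`, which is not known here. Replacing `B` by `tB` with `t
< 1` gives solutions with `X w₁ ≤ t w₂` and `Y w₂ ≤ w₁`, so `XY w₂ ≤ t w₂` and `1 - XY` is
invertible. Both sides are continuous, and `t → 1` gives the identity. -/
theorem charpoly_blockH (hB : Nonneg B) (hC : Nonneg C)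
    (hA : ∀ i j, i ≠ j → A i j ≤ 0) (hD : ∀ i j, i ≠ j → D i j ≤ 0)
    (had : ∀ i j, 0 < A i i + D j j) {w₁ : Fin n → ℝ} {w₂ : Fin m → ℝ}
    (hw₁ : ∀ i, 0 < w₁ i) (hw₂ : ∀ i, 0 < w₂ i)
    (h₁ : ∀ i, (C *ᵥ w₂) i ≤ (D *ᵥ w₁) i) (h₂ : ∀ i, (B *ᵥ w₁) i ≤ (A *ᵥ w₂) i)
    {Φ : Matrix (Fin m) (Fin n) ℝ} {Ψ : Matrix (Fin n) (Fin m) ℝ}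
    (hΦ : IsMinNonnegSolution A B C D Φ) (hΨ : IsMinNonnegSolution D C B A Ψ) :
    (blockH A B C D).charpoly = (D - C * Φ).charpoly * (-(A - B * Ψ)).charpoly := by
  -- The shift by two keeps `t 0 = 1/2` positive, so that `t k • w₂` is still a positive test
  -- vector.
  let t : ℕ → ℝ := fun k => 1 - 1 / ((k : ℝ) + 1 + 1)
  have ht0 : ∀ k, 0 < t k := fun k => by
    have : 1 / ((k : ℝ) + 1 + 1) < 1 := by
      rw [div_lt_one (by positivity)]; have : (0 : ℝ) ≤ k := k.cast_nonneg
      linarith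
    simp only [t]; linarith
  have ht1 : ∀ k, t k < 1 := fun k => by
    have : 0 < 1 / ((k : ℝ) + 1 + 1) := by positivity
    simp only [t]; linarith
  have htmono : Monotone t := fun k l hkl => by
    simp only [t]; gcongr
  have htlim : Tendsto t atTop (𝓝 1) := by
    have h := (tendsto_add_atTop_iff_nat 1).2 (tendsto_one_div_add_atTop_nhds_zero_nat (𝕜 := ℝ))
    have := h.const_sub 1
    simpa [t] using this
  have htB : ∀ k, Nonneg (t k • B) := fun k i j => mul_nonneg (ht0 k).le (hB i j)
  have htBmono : ∀ i j, Monotone fun k => (t k • B) i j := fun i j k l hkl =>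
    mul_le_mul_of_nonneg_right (htmono hkl) (hB i j)
  have htBlim : Tendsto (fun k => t k • B) atTop (𝓝 B) := by
    simpa using htlim.smul_const B
  have htw : ∀ k i, 0 < (t k • w₂) i := fun k i => mul_pos (ht0 k) (hw₂ i)
  have htBw : ∀ k i, ((t k • B) *ᵥ w₁) i = t k * (B *ᵥ w₁) i := fun k i => by
    rw [smul_mulVec, Pi.smul_apply, smul_eq_mul]
  have hex : ∀ k, _ := fun k => exists_least_supersolution (htB k) hC hA hD had hw₁ (htw k)
    (fun i => by
      rw [mulVec_smul, Pi.smul_apply, smul_eq_mul]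
      refine le_trans ?_ (h₁ i)
      exact mul_le_of_le_one_left (hC.mulVec_nonneg (fun k => (hw₂ k).le) i) (ht1 k).le)
    (fun i => by
      rw [htBw, mulVec_smul, Pi.smul_apply, smul_eq_mul]
      exact mul_le_mul_of_nonneg_left (h₂ i) (ht0 k).le)
  -- The dual equation keeps the unscaled pair `(w₂, w₁)`; the factor `t` is gained from `X` alone.
  have hex' : ∀ k, _ := fun k => exists_least_supersolution hC (htB k) hD hA
    (fun i j => by rw [add_comm]; exact had j i) hw₂ hw₁ (fun i => by
      rw [htBw]
      refine le_trans ?_ (h₂ i)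
      exact mul_le_of_le_one_left (hB.mulVec_nonneg (fun k => (hw₁ k).le) i) (ht1 k).le) h₁
  choose X hX hXw hXleast using hex
  choose Y hY hYw hYleast using hex'
  have hXlim : Tendsto X atTop (𝓝 Φ) :=
    tendsto_least_supersolution (fun _ => hC) htBmono (fun _ _ => monotone_const) htBlim
      tendsto_const_nhds hX hXleast hΦ
  have hYlim : Tendsto Y atTop (𝓝 Ψ) :=
    tendsto_least_supersolution (Bk := fun _ => C) htB (fun _ _ => monotone_const) htBmono tendsto_const_nhds
      htBlim hY hYleast hΨ
  have hdet : ∀ k, (1 - X k * Y k).det ≠ 0 := fun k => by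
    refine det_one_sub_ne_zero_of_mulVec_le ((hX k).1.mul (hY k).1) hw₂ (ht0 k) (ht1 k)
      fun i => ?_
    rw [← mulVec_mulVec]
    exact ((hX k).1.mulVec_mono (hYw k) i).trans (hXw k i)
  refine Polynomial.funext fun z => ?_
  rw [Polynomial.eval_mul, eval_charpoly, eval_charpoly, eval_charpoly]
  let f : Matrix (Fin m) (Fin n) ℝ × Matrix (Fin m) (Fin n) ℝ × Matrix (Fin n) (Fin m) ℝ → ℝ :=
    fun p => (scalar _ z - blockH A p.1 C D).det -
      (scalar _ z - (D - C * p.2.1)).det * (scalar _ z - -(A - p.1 * p.2.2)).det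
  have hf : Continuous f := by
    have hH : Continuous fun p : Matrix (Fin m) (Fin n) ℝ × Matrix (Fin m) (Fin n) ℝ ×
        Matrix (Fin n) (Fin m) ℝ => blockH A p.1 C D := by
      simp only [blockH_eq]
      exact continuous_const.matrix_fromBlocks continuous_const continuous_fst continuous_const
    refine Continuous.sub (Continuous.matrix_det (continuous_const.sub hH)) (Continuous.mul ?_ ?_)
    · exact Continuous.matrix_det (by fun_prop)
    · exact Continuous.matrix_det (by fun_prop)
  refine sub_eq_zero.1 (tendsto_nhds_unique
    ((hf.tendsto (B, Φ, Ψ)).comp (htBlim.prodMk_nhds (hXlim.prodMk_nhds hYlim))) ?_)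
  refine tendsto_const_nhds.congr fun k => ?_
  exact (sub_eq_zero.2 (det_scalar_sub_blockH (hX k).2 (hY k).2 (hdet k) z)).symm

end Limit

/-! ### A Jordan block at zero -/

section Jordan

/-- If the kernel of `f` is a line and `0` is a multiple root of the characteristic polynomial,
then every kernel vector is in the range of `f`. -/
theorem mem_range_of_two_le_rootMultiplicity {K V : Type*} [Field K] [AddCommGroup V] [Module K V]
    [FiniteDimensional K V] (f : Module.End K V)
    (hker : Module.finrank K (f.eigenspace 0) = 1)
    (h : 2 ≤ f.charpoly.rootMultiplicity 0) {v : V} (hv : f v = 0) : ∃ y, f y = v := by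
  have hmem : ∀ x, x ∈ f.eigenspace 0 ↔ f x = 0 := fun x => by
    rw [Module.End.mem_eigenspace_iff, zero_smul]
  -- Otherwise the kernels of the powers stop growing at `ker f`, and the generalized eigenspace has
  -- dimension 1, against a multiplicity of at least 2. The nonzero `f y` then spans the kernel.
  obtain ⟨y, hy, hy0⟩ : ∃ y, f (f y) = 0 ∧ f y ≠ 0 := by
    by_contra! hcon
    have hpow : ∀ k x, (f ^ k) x = 0 → x = 0 ∨ f x = 0 := by
      intro k
      induction k with
      | zero => intro x hx; exact Or.inl (by simpa using hx)
      | succ k ih =>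
        intro x hx
        rw [pow_succ, Module.End.mul_apply] at hx
        rcases ih _ hx with h' | h'
        · exact Or.inr h'
        · exact Or.inr (hcon _ h')
    have hle : f.maxGenEigenspace 0 ≤ f.eigenspace 0 := by
      intro x hx
      obtain ⟨k, hk⟩ := (f.mem_maxGenEigenspace 0 x).1 hx
      rw [zero_smul, sub_zero] at hk
      rw [hmem]
      rcases hpow k x hk with h' | h'
      · rw [h', map_zero]
      · exact h'
    have := Submodule.finrank_mono hle
    rw [LinearMap.finrank_maxGenEigenspace_eq, hker] at this
    omega
  have hz : (⟨f y, (hmem _).2 hy⟩ : f.eigenspace 0) ≠ 0 := fun h => hy0 (congrArg Subtype.val h)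
  obtain ⟨c, hc⟩ := (finrank_eq_one_iff_of_nonzero' _ hz).1 hker ⟨v, (hmem _).2 hv⟩
  exact ⟨c • y, by rw [map_smul]; exact congrArg Subtype.val hc⟩

end Jordan

/-! ### Consequences of a one-dimensional kernel, and the theorem -/

section Main

variable {n m : ℕ} {A : Matrix (Fin m) (Fin m) ℝ} {B : Matrix (Fin m) (Fin n) ℝ}
  {C : Matrix (Fin n) (Fin m) ℝ} {D : Matrix (Fin n) (Fin n) ℝ}

theorem IsMMatrix.offDiag_nonpos {ι : Type*} [Fintype ι] [DecidableEq ι] {M : Matrix ι ι ℝ}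
    (h : IsMMatrix M) (i j : ι) (hij : i ≠ j) : M i j ≤ 0 := by
  obtain ⟨s, N, hN, rfl, -⟩ := h
  simpa [hij] using hN i j

/-- A matrix whose kernel is a line has at most one zero row. -/
theorem not_two_zero_rows {ι : Type*} [Fintype ι] [DecidableEq ι] {M : Matrix ι ι ℝ}
    (hker : Module.finrank ℝ (LinearMap.ker M.mulVecLin) = 1) {p q : ι} (hpq : p ≠ q)
    (hp : ∀ j, M p j = 0) (hq : ∀ j, M q j = 0) : False := by
  -- Row rank equals column rank, so the left kernel is a line too; two zero rows would put two
  -- independent basis vectors in it.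
  have hk : Module.finrank ℝ (LinearMap.ker Mᵀ.mulVecLin) = 1 := by
    have h1 := LinearMap.finrank_range_add_finrank_ker M.mulVecLin
    have h2 := LinearMap.finrank_range_add_finrank_ker Mᵀ.mulVecLin
    have h3 := Matrix.rank_transpose M
    unfold Matrix.rank at h3
    omega
  have hmem : ∀ r, (∀ j, M r j = 0) → Pi.single r (1 : ℝ) ∈ LinearMap.ker Mᵀ.mulVecLin := by
    intro r hr
    rw [LinearMap.mem_ker, mulVecLin_apply]
    ext j
    simp [hr]
  have hz : (⟨_, hmem p hp⟩ : LinearMap.ker Mᵀ.mulVecLin) ≠ 0 := fun h => by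
    simpa using congrFun (congrArg Subtype.val h) p
  obtain ⟨c, hc⟩ := (finrank_eq_one_iff_of_nonzero' _ hz).1 hk ⟨_, hmem q hq⟩
  simpa [hpq.symm] using congrFun (congrArg Subtype.val hc) q

theorem row_eq_zero_of_diag_eq_zero {ι : Type*} [Fintype ι] [DecidableEq ι] {M : Matrix ι ι ℝ}
    (hM : ∀ i j, i ≠ j → M i j ≤ 0) {w : ι → ℝ} (hw : ∀ i, 0 < w i) {i : ι}
    (h : 0 ≤ (M *ᵥ w) i) (hi : M i i = 0) (j : ι) : M i j = 0 := by
  rw [mulVec_eq_diag_sub, hi, zero_mul] at h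
  have hN := nonneg_negOffDiag hM
  have h1 := hN.mulVec_nonneg (fun k => (hw k).le) i
  have := eq_zero_of_mulVec_eq_zero hN hw (i := i) (by linarith) j
  by_cases hij : i = j
  · rw [← hij, hi]
  · simpa [negOffDiag, hij] using this

theorem mulVec_blockH_eq_zero {x : Fin n ⊕ Fin m → ℝ} :
    blockH A B C D *ᵥ x = 0 ↔ blockK A B C D *ᵥ x = 0 := by
  rw [blockH, ← mulVec_mulVec]
  refine ⟨fun h => ?_, fun h => by rw [h, mulVec_zero]⟩
  have := congrArg (fromBlocks (1 : Matrix (Fin n) (Fin n) ℝ) 0 0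
    (-1 : Matrix (Fin m) (Fin m) ℝ) *ᵥ ·) h
  simpa [mulVec_mulVec, ← Matrix.mul_assoc, fromBlocks_multiply] using this

theorem IsMinNonnegSolution.eq {X Y : Matrix (Fin m) (Fin n) ℝ}
    (hX : IsMinNonnegSolution A B C D X) (hY : IsMinNonnegSolution A B C D Y) : X = Y := by
  ext i j
  exact le_antisymm (hX.2 _ hY.1 i j) (hY.2 _ hX.1 i j)

end Main

end MRiccati

open MRiccati in
theorem theorem2p1 (n m : ℕ)
    (A : Matrix (Fin m) (Fin m) ℝ) (B : Matrix (Fin m) (Fin n) ℝ)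
    (C : Matrix (Fin n) (Fin m) ℝ) (D : Matrix (Fin n) (Fin n) ℝ)
    (hreg : MRiccati.IsRegularMMatrix (MRiccati.blockK A B C D))
    (hsing : MRiccati.IsSingularMMatrix (MRiccati.blockK A B C D))
    (hker : Module.finrank ℝ
      (Module.End.eigenspace (Matrix.toLin' (MRiccati.blockH A B C D)) (0 : ℝ)) = 1)
    (u₁ v₁ : Fin n → ℝ) (u₂ v₂ : Fin m → ℝ)
    (hu0 : Sum.elim u₁ u₂ ≠ 0) (hv0 : Sum.elim v₁ v₂ ≠ 0)
    (hu : Matrix.vecMul (Sum.elim u₁ u₂) (MRiccati.blockK A B C D) = 0)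
    (hv : Matrix.mulVec (MRiccati.blockK A B C D) (Sum.elim v₁ v₂) = 0)
    (huv : u₁ ⬝ᵥ v₁ ≠ u₂ ⬝ᵥ v₂) :
    (∃ Φ : Matrix (Fin m) (Fin n) ℝ, MRiccati.IsMinNonnegSolution A B C D Φ) ∧
    (∃ Ψ : Matrix (Fin n) (Fin m) ℝ, MRiccati.IsMinNonnegSolution D C B A Ψ) ∧
    ∀ (Φ : Matrix (Fin m) (Fin n) ℝ) (Ψ : Matrix (Fin n) (Fin m) ℝ),
      MRiccati.IsMinNonnegSolution A B C D Φ →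
      MRiccati.IsMinNonnegSolution D C B A Ψ →
        MRiccati.IsNonsingularMMatrix ((1 : Matrix (Fin m) (Fin m) ℝ) - Φ * Ψ) ∧
        MRiccati.IsNonsingularMMatrix ((1 : Matrix (Fin n) (Fin n) ℝ) - Ψ * Φ) := by
  obtain ⟨hKM, w, hw, hKw⟩ := hreg
  have hK := hKM.offDiag_nonpos
  have hA : ∀ i j, i ≠ j → A i j ≤ 0 := fun i j h =>
    hK (Sum.inr i) (Sum.inr j) fun e => h (Sum.inr_injective e)
  have hD : ∀ i j, i ≠ j → D i j ≤ 0 := fun i j h =>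
    hK (Sum.inl i) (Sum.inl j) fun e => h (Sum.inl_injective e)
  have hB : Nonneg B := fun i j => neg_nonpos.1 (hK (Sum.inr i) (Sum.inl j) (by simp))
  have hC : Nonneg C := fun i j => neg_nonpos.1 (hK (Sum.inl i) (Sum.inr j) (by simp))
  have hkerK : Module.finrank ℝ (LinearMap.ker (blockK A B C D).mulVecLin) = 1 := by
    have : LinearMap.ker (blockK A B C D).mulVecLin =
        Module.End.eigenspace (Matrix.toLin' (blockH A B C D)) (0 : ℝ) := by
      ext x
      rw [LinearMap.mem_ker, Matrix.mulVecLin_apply, Module.End.mem_eigenspace_iff, zero_smul,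
        Matrix.toLin'_apply, mulVec_blockH_eq_zero]
    rw [this, hker]
  -- The denominators of the iteration: if one vanished, both diagonal entries would be zero and `K`
  -- would have two zero rows.
  have had : ∀ i j, 0 < A i i + D j j := by
    intro i j
    have hAi : 0 ≤ A i i := diag_nonneg_of_mulVec_nonneg hK hw (hKw (Sum.inr i))
    have hDj : 0 ≤ D j j := diag_nonneg_of_mulVec_nonneg hK hw (hKw (Sum.inl j))
    refine (add_nonneg hAi hDj).lt_of_ne fun h => ?_
    exact not_two_zero_rows hkerK (p := Sum.inr i) (q := Sum.inl j) (by simp)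
      (row_eq_zero_of_diag_eq_zero hK hw (hKw _) (by
        simp only [blockK, Matrix.fromBlocks_apply₂₂]; linarith))
      (row_eq_zero_of_diag_eq_zero hK hw (hKw _) (by
        simp only [blockK, Matrix.fromBlocks_apply₁₁]; linarith))
  have hda : ∀ i j, 0 < D i i + A j j := fun i j => by rw [add_comm]; exact had j i
  set w₁ : Fin n → ℝ := w ∘ Sum.inl with hw₁def
  set w₂ : Fin m → ℝ := w ∘ Sum.inr with hw₂def
  have hw₁ : ∀ i, 0 < w₁ i := fun i => hw _
  have hw₂ : ∀ i, 0 < w₂ i := fun i => hw _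
  have h₁ : ∀ i, (C.mulVec w₂) i ≤ (D.mulVec w₁) i := fun i => by
    have := hKw (Sum.inl i)
    rw [blockK, Matrix.fromBlocks_mulVec] at this
    simp only [Sum.elim_inl, Pi.add_apply, Matrix.neg_mulVec, Pi.neg_apply] at this
    linarith
  have h₂ : ∀ i, (B.mulVec w₁) i ≤ (A.mulVec w₂) i := fun i => by
    have := hKw (Sum.inr i)
    rw [blockK, Matrix.fromBlocks_mulVec] at this
    simp only [Sum.elim_inr, Pi.add_apply, Matrix.neg_mulVec, Pi.neg_apply] at this
    linarith
  obtain ⟨Φ₀, hΦ₀, hΦ₀w, hΦ₀l⟩ := exists_least_supersolution hB hC hA hD had hw₁ hw₂ h₁ h₂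
  obtain ⟨Ψ₀, hΨ₀, hΨ₀w, hΨ₀l⟩ := exists_least_supersolution hC hB hD hA hda hw₂ hw₁ h₂ h₁
  have hΦmin : IsMinNonnegSolution A B C D Φ₀ := ⟨hΦ₀, fun Y hY =>
    hΦ₀l Y hY.1 fun i j => (congrFun (congrFun hY.2 i) j).le⟩
  have hΨmin : IsMinNonnegSolution D C B A Ψ₀ := ⟨hΨ₀, fun Y hY =>
    hΨ₀l Y hY.1 fun i j => (congrFun (congrFun hY.2 i) j).le⟩
  refine ⟨⟨Φ₀, hΦmin⟩, ⟨Ψ₀, hΨmin⟩, fun Φ Ψ hΦ hΨ => ?_⟩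
  obtain rfl := hΦ.eq hΦmin
  obtain rfl := hΨ.eq hΨmin
  have hdet : (1 - Φ * Ψ).det ≠ 0 := by
    intro hdet
    have hRw : ∀ i, 0 ≤ ((D - C * Φ).mulVec w₁) i := fun i => by
      have e1 := h₁ i
      have e2 := hC.mulVec_mono hΦ₀w i
      rw [Matrix.sub_mulVec, ← Matrix.mulVec_mulVec, Pi.sub_apply]
      linarith
    have hSw : ∀ i, 0 ≤ ((A - B * Ψ).mulVec w₂) i := fun i => by
      have e1 := h₂ i
      have e2 := hB.mulVec_mono hΨ₀w i
      rw [Matrix.sub_mulVec, ← Matrix.mulVec_mulVec, Pi.sub_apply]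
      linarith
    obtain ⟨hR0, hS0⟩ := det_eq_zero_and_det_eq_zero hΦ.1.2 hΨ.1.2 hdet
      (fun i j hij => by
        have e1 := hD i j hij
        have e2 := (hC.mul hΦ.1.1) i j
        rw [Matrix.sub_apply]; linarith)
      (fun i j hij => by
        have e1 := hA i j hij
        have e2 := (hB.mul hΨ.1.1) i j
        rw [Matrix.sub_apply]; linarith) hw₁ hw₂ hRw hSw
    have hS0' : (-(A - B * Ψ)).det = 0 := by rw [Matrix.det_neg, hS0, mul_zero]
    have hroot : ∀ {k : ℕ} (M : Matrix (Fin k) (Fin k) ℝ), M.det = 0 →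
        1 ≤ M.charpoly.rootMultiplicity 0 := fun M hM =>
      (Polynomial.rootMultiplicity_pos M.charpoly_monic.ne_zero).2 (by
        rw [Polynomial.IsRoot, Matrix.eval_charpoly, map_zero, zero_sub, Matrix.det_neg, hM,
          mul_zero])
    -- Each of the factors `R` and `-S` contributes one root at `0`.
    have hmult : 2 ≤ (Matrix.toLin' (blockH A B C D)).charpoly.rootMultiplicity 0 := by
      rw [Matrix.charpoly_toLin', charpoly_blockH hB hC hA hD had hw₁ hw₂ h₁ h₂ hΦ hΨ,
        Polynomial.rootMultiplicity_mul
          (mul_ne_zero (Matrix.charpoly_monic _).ne_zero (Matrix.charpoly_monic _).ne_zero)]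
      have := hroot _ hR0
      have := hroot _ hS0'
      omega
    obtain ⟨y, hy⟩ := mem_range_of_two_le_rootMultiplicity _ hker hmult
      (v := Sum.elim v₁ v₂) (by rw [Matrix.toLin'_apply, mulVec_blockH_eq_zero]; exact hv)
    rw [Matrix.toLin'_apply] at hy
    have e : Sum.elim u₁ (-u₂) ⬝ᵥ Sum.elim v₁ v₂ = 0 := by
      -- With `J = diag(1, -1)`, `H = J K` and `J² = 1`, so `(uᵀJ) H = uᵀK = 0`.
      have hJ : Matrix.vecMul (Sum.elim u₁ (-u₂)) (blockH A B C D) = 0 := by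
        rw [blockH, ← Matrix.vecMul_vecMul, Matrix.vecMul_fromBlocks]
        simpa [Matrix.vecMul_neg, Matrix.neg_vecMul] using hu
      rw [← hy, Matrix.dotProduct_mulVec, hJ, zero_dotProduct]
    rw [sumElim_dotProduct_sumElim, neg_dotProduct] at e
    exact huv (by linarith)
  have hdet' : (1 - Ψ * Φ).det ≠ 0 := by
    rwa [Matrix.det_one_sub_mul_comm]
  refine ⟨isNonsingularMMatrix_one_sub (hΦ.1.1.mul hΨ.1.1) hw₂ (fun i => ?_) hdet,
    isNonsingularMMatrix_one_sub (hΨ.1.1.mul hΦ.1.1) hw₁ (fun i => ?_) hdet'⟩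
  · rw [← Matrix.mulVec_mulVec]
    exact (hΦ.1.1.mulVec_mono hΨ₀w i).trans (hΦ₀w i)
  · rw [← Matrix.mulVec_mulVec]
    exact (hΨ.1.1.mulVec_mono hΦ₀w i).trans (hΨ₀w i)
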